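/- Let $\mathbb{D}$ be the open unit disc in $\mathbb{C}$ and let $\operatorname{Hol}(\mathbb{D})$ be the Fréchet space of holomorphic functions on $\mathbb{D}$ with the topology of uniform convergence on compact subsets of $\mathbb{D}$. Let $\varphi:\mathbb{D}\to\mathbb{D}$ be a holomorphic map that is not an automorphism of $\mathbb{D}$ and has a fixed point $\alpha\in\mathbb{D}$ with $\varphi'(\alpha)\neq 0$. Let $\kappa\in\operatorname{Hol}(\mathbb{D})$ be the Koenigs eigenfunction of $\varphi$, i.e. the unique function in $\operatorname{Hol}(\mathbb{D})$ with $\kappa\circ\varphi=\varphi'(\alpha)\,\kappa$ and $\kappa'(\alpha)=1$. Then $\operatorname{Span}\{\kappa^n : n\in\mathbb{N}_0\}$, where $\mathbb{N}_0=\{0,1,2,\dots\}$, is dense in $\operatorname{Hol}(\mathbb{D})$ if and only if $\varphi$ is univalent (injective on $\mathbb{D}$). -/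

import Mathlib

namespace Koenigs

/-- The open unit disc of the complex plane. -/
abbrev disc : Set ℂ := Metric.ball (0 : ℂ) 1

/-- `f` is a holomorphic map of the open unit disc into itself
(its values outside the disc play no role). -/
def IsHolSelfMap (f : ℂ → ℂ) : Prop :=
  DifferentiableOn ℂ f disc ∧ Set.MapsTo f disc disc

/-- `f` is an automorphism of the open unit disc: a holomorphic self-map with a holomorphic
two-sided inverse. -/
def IsDiscAut (f : ℂ → ℂ) : Prop :=
  IsHolSelfMap f ∧ ∃ g : ℂ → ℂ, IsHolSelfMap g ∧
    Set.LeftInvOn g f disc ∧ Set.RightInvOn g f disc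

/-- `φ` is a Schröder map with fixed point `α` in the open unit disc. -/
structure IsSchroederMap (φ : ℂ → ℂ) (α : ℂ) : Prop where
  holSelfMap : IsHolSelfMap φ
  not_aut : ¬ IsDiscAut φ
  mem_disc : α ∈ disc
  fixed : φ α = α
  deriv_ne_zero : deriv φ α ≠ 0

/-- The algebra `Hol(𝔻)` of holomorphic functions on the open unit disc. Its topology is the one
inherited from the compact-open topology of `C(𝔻, ℂ)`, that is, the topology of uniform
convergence on compact subsets of the disc. -/
def Hol : Subalgebra ℂ C(disc, ℂ) where
  carrier := {f | ∃ F : ℂ → ℂ, DifferentiableOn ℂ F disc ∧ ∀ z : disc, f z = F z}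
  mul_mem' := by
    rintro f g ⟨F, hF, hf⟩ ⟨G, hG, hg⟩
    exact ⟨fun z => F z * G z, hF.mul hG, fun z => by simp [hf, hg]⟩
  add_mem' := by
    rintro f g ⟨F, hF, hf⟩ ⟨G, hG, hg⟩
    exact ⟨fun z => F z + G z, hF.add hG, fun z => by simp [hf, hg]⟩
  algebraMap_mem' := fun c => ⟨fun _ => c, differentiableOn_const c, fun _ => rfl⟩

/-- The element of `Hol(𝔻)` given by a function that is holomorphic on the disc. -/
def toHol (F : ℂ → ℂ) (hF : DifferentiableOn ℂ F disc) : Hol :=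
  ⟨⟨fun z => F z, hF.continuousOn.domRestrict⟩, F, hF, fun _ => rfl⟩

/-- `κ` is the Koenigs eigenfunction of the Schröder map `φ` with fixed point `α`: it is
holomorphic on the disc, `κ ∘ φ = φ'(α) κ` there, and `κ'(α) = 1`. -/
structure IsKoenigsEigenfunction (φ : ℂ → ℂ) (α : ℂ) (κ : ℂ → ℂ) : Prop where
  hol : DifferentiableOn ℂ κ disc
  eigen : ∀ z ∈ disc, κ (φ z) = deriv φ α * κ z
  deriv_eq_one : deriv κ α = 1

end Koenigs

/-! ### Runge approximation by polynomials in an injective function. -/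

namespace Koenigs

open Metric Set Filter Topology Polynomial

/-! Both conditions amount to injectivity of `κ`. If the powers span densely, then `κ a = κ b`
forces `f a = f b` for every holomorphic `f`, so `κ` is injective; the eigenvalue equation then
makes `φ` injective. Conversely, by the Schwarz lemma the iterates of `φ` converge to `α`, near
which `κ` is injective. As `κ ∘ φ^[n] = φ'(α)^n κ`, an equality `κ a = κ b` gives `φ^[n] a = φ^[n]
b` for some `n`, hence `a = b` if `φ` is injective (`IsKoenigsEigenfunction.injOn`). Density for
injective `κ` is Runge's theorem on `κ(𝔻)`, proved with Banach algebras (`exists_mem_elemental_eq`).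
In the closed algebra generated by `κ` on `|z| ≤ r`, each `κ w` with `r < |w| < 1` is in the
resolvent set of `κ`, so a Cauchy integral of resolvents puts `f` in that algebra. -/

lemma isPreconnected_annulus {r s : ℝ} (hr : 0 ≤ r) :
    IsPreconnected {w : ℂ | r < ‖w‖ ∧ ‖w‖ < s} := by
  have h : {w : ℂ | r < ‖w‖ ∧ ‖w‖ < s} =
      (fun p : ℝ × ℝ => (p.1 : ℂ) * Complex.exp (p.2 * Complex.I)) '' (Ioo r s ×ˢ univ) := by
    ext w
    simp only [mem_ofPred_eq, mem_image, mem_prod, mem_Ioo, mem_univ, and_true, Prod.exists]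
    constructor
    · intro hw
      exact ⟨‖w‖, Complex.arg w, hw, Complex.norm_mul_exp_arg_mul_I w⟩
    · rintro ⟨t, θ, ht, rfl⟩
      have : ‖(t : ℂ) * Complex.exp (θ * Complex.I)‖ = t := by
        rw [norm_mul, Complex.norm_exp_ofReal_mul_I, mul_one, Complex.norm_real,
          Real.norm_of_nonneg (hr.trans ht.1.le)]
      rwa [this]
  rw [h]
  exact (isPreconnected_Ioo.prod isPreconnected_univ).image _ (by fun_prop)

lemma image_mem_nhds_of_injOn {κ : ℂ → ℂ} {U : Set ℂ} (hU : IsOpen U)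
    (hκ : DifferentiableOn ℂ κ U) (hinj : InjOn κ U) {z : ℂ} (hz : z ∈ U) :
    κ '' U ∈ 𝓝 (κ z) := by
  have hUz := hU.mem_nhds hz
  rcases (hκ.analyticAt hUz).eventually_constant_or_nhds_le_map_nhds with h | h
  · exfalso
    have h1 : ∀ᶠ w in 𝓝[≠] z, w = z := by
      filter_upwards [h.filter_mono nhdsWithin_le_nhds, nhdsWithin_le_nhds hUz] with w hw hwU
      exact hinj hwU hz hw
    obtain ⟨w, hw, hw'⟩ := (h1.and self_mem_nhdsWithin).exists
    exact hw' hw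
  · exact h (image_mem_map hUz)

/-- The restriction of a function holomorphic on the disc to a smaller closed disc. -/
def restrictClosedBall (κ : ℂ → ℂ) (hκ : DifferentiableOn ℂ κ disc) {r : ℝ} (hr : r < 1) :
    C(closedBall (0 : ℂ) r, ℂ) :=
  ⟨fun z => κ z, (hκ.continuousOn.mono (closedBall_subset_ball hr)).domRestrict⟩

/-- Off the smaller closed disc, the values of an injective holomorphic function `κ` lie in the
resolvent set of `κ` relative to the closed algebra that it generates. -/
lemma mem_resolventSet_elemental {κ : ℂ → ℂ} (hκ : DifferentiableOn ℂ κ disc)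
    (hinj : InjOn κ disc) {r : ℝ} (hr0 : 0 ≤ r) (hr : r < 1) {w : ℂ} (hrw : r < ‖w‖)
    (hw : ‖w‖ < 1) :
    κ w ∈ resolventSet ℂ (⟨restrictClosedBall κ hκ hr, Algebra.elemental.self_mem ℂ _⟩ :
      Algebra.elemental ℂ (restrictClosedBall κ hκ hr)) := by
  set k := restrictClosedBall κ hκ hr with hk
  set a : Algebra.elemental ℂ k := ⟨k, Algebra.elemental.self_mem ℂ _⟩ with ha
  have hsub := closedBall_subset_ball (x := (0 : ℂ)) hr
  -- Passing to a closed subalgebra can only fill holes of the spectrum, so its boundary stays in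
  -- the spectrum relative to all continuous functions.
  have hfr : frontier (spectrum ℂ a) ⊆ range k := by
    rw [← ContinuousMap.spectrum_eq_range k]
    exact Subalgebra.frontier_spectrum _ a
  have hrange : range k ⊆ spectrum ℂ a := by
    rw [← ContinuousMap.spectrum_eq_range k]
    exact spectrum.subset_subalgebra a
  have hclosed : IsClosed (spectrum ℂ a) := spectrum.isClosed a
  set P : Set ℂ := {w : ℂ | r < ‖w‖ ∧ ‖w‖ < 1} with hP
  have hPd : P ⊆ disc := fun w hw => mem_ball_zero_iff.2 hw.2
  have hPc : IsPreconnected (κ '' P) :=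
    (isPreconnected_annulus hr0).image _ (hκ.continuousOn.mono hPd)
  -- By injectivity `κ '' P` misses the range of `k`, hence the boundary of the spectrum; being
  -- connected, it lies on one side.
  have hcov : κ '' P ⊆ (spectrum ℂ a)ᶜ ∪ interior (spectrum ℂ a) := by
    rintro _ ⟨v, hv, rfl⟩
    by_cases h : κ v ∈ spectrum ℂ a
    · right
      by_contra h'
      obtain ⟨y, hy⟩ := hfr ⟨subset_closure h, h'⟩
      have : (y : ℂ) = v := hinj (hsub y.2) (hPd hv) hy
      have hy2 := mem_closedBall_zero_iff.1 y.2
      rw [this] at hy2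
      exact absurd hv.1 (not_lt.2 hy2)
    · exact Or.inl h
  -- Near a boundary point of the spectrum, the open mapping property gives values of `κ` outside
  -- the spectrum; these cannot be taken on `|z| ≤ r`.
  have hne : (κ '' P ∩ (spectrum ℂ a)ᶜ).Nonempty := by
    have hs1 : (spectrum ℂ a).Nonempty :=
      ⟨k ⟨0, mem_closedBall_self hr0⟩, hrange (mem_range_self _)⟩
    have hs2 : spectrum ℂ a ≠ univ := (spectrum.isCompact a).ne_univ
    obtain ⟨c, hc⟩ := nonempty_frontier_iff.2 ⟨hs1, hs2⟩
    obtain ⟨y, hy⟩ := hfr hc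
    have hnh : κ '' disc ∈ 𝓝 c := by
      rw [← hy]
      exact image_mem_nhds_of_injOn isOpen_ball hκ hinj (hsub y.2)
    rw [← frontier_compl] at hc
    obtain ⟨_, ⟨v, hv, rfl⟩, hv'⟩ := mem_closure_iff_nhds.1 hc.1 _ hnh
    refine ⟨κ v, ⟨v, ⟨?_, mem_ball_zero_iff.1 hv⟩, rfl⟩, hv'⟩
    by_contra hle
    exact hv' (hrange ⟨⟨v, mem_closedBall_zero_iff.2 (not_lt.1 hle)⟩, rfl⟩)
  have := hPc.subset_left_of_subset_union hclosed.isOpen_compl isOpen_interior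
    (disjoint_compl_left.mono_right interior_subset) hcov hne
  have h2 := this ⟨w, ⟨hrw, hw⟩, rfl⟩
  simpa [spectrum] using h2

/-- This is Cauchy's formula for `f κ' / dslope κ z`, which is holomorphic because injectivity and
`hd` keep the denominator nonzero, and which equals `f z` at `z`. -/
lemma circleIntegral_mul_deriv_div_sub {κ f : ℂ → ℂ} (hκ : DifferentiableOn ℂ κ disc)
    (hinj : InjOn κ disc) (hf : DifferentiableOn ℂ f disc) {R : ℝ} (hR : R < 1) {z : ℂ}
    (hz : ‖z‖ < R) (hd : deriv κ z ≠ 0) :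
    (∮ w in C(0, R), f w * deriv κ w * (κ w - κ z)⁻¹) = 2 * Real.pi * Complex.I * f z := by
  have hzd : z ∈ disc := mem_ball_zero_iff.2 (hz.trans hR)
  have hds : DifferentiableOn ℂ (dslope κ z) disc :=
    (Complex.differentiableOn_dslope (isOpen_ball.mem_nhds hzd)).2 hκ
  have hne : ∀ w ∈ disc, dslope κ z w ≠ 0 := by
    intro w hw
    rcases eq_or_ne w z with rfl | h
    · simpa using hd
    · rw [dslope_of_ne _ h, slope_def_field]
      exact div_ne_zero (sub_ne_zero.2 fun h' => h (hinj hw hzd h')) (sub_ne_zero.2 h)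
  have hq : DifferentiableOn ℂ (fun w => f w * deriv κ w / dslope κ z w) (closedBall 0 R) :=
    ((hf.mul (hκ.deriv isOpen_ball)).div hds hne).mono (closedBall_subset_ball hR)
  have hR0 : 0 ≤ R := (norm_nonneg z).trans hz.le
  have key := hq.circleIntegral_sub_inv_smul (mem_ball_zero_iff.2 hz)
  simp only [dslope_same, smul_eq_mul, mul_div_cancel_right₀ _ hd] at key
  rw [← key]
  refine circleIntegral.integral_congr hR0 fun w hw => ?_
  have hwz : w ≠ z := by
    rintro rfl
    rw [mem_sphere_zero_iff_norm] at hw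
    exact hz.ne hw
  simp only [dslope_of_ne _ hwz, slope_def_field]
  have h1 : w - z ≠ 0 := sub_ne_zero.2 hwz
  have h2 : κ w - κ z ≠ 0 := sub_ne_zero.2 fun h' =>
    hwz (hinj (mem_ball_zero_iff.2 (by rw [mem_sphere_zero_iff_norm.1 hw]; exact hR)) hzd h')
  field_simp

lemma eventually_deriv_ne_zero_of_injOn {κ : ℂ → ℂ} {U : Set ℂ} (hU : IsOpen U)
    (hUc : IsPreconnected U) (hκ : DifferentiableOn ℂ κ U) (hinj : InjOn κ U) {z : ℂ}
    (hz : z ∈ U) : ∀ᶠ w in 𝓝[≠] z, deriv κ w ≠ 0 := by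
  by_contra h
  have h0 : EqOn (deriv κ) 0 U :=
    ((hκ.deriv hU).analyticOnNhd hU).eqOn_zero_of_preconnected_of_frequently_eq_zero hUc hz
      h
  obtain ⟨w, hwU, hwz⟩ := ((eventually_mem_nhdsWithin (a := z) (s := {z}ᶜ)).and
    (nhdsWithin_le_nhds (hU.mem_nhds hz))).exists
  exact hwU (hinj hwz hz (hU.is_const_of_deriv_eq_zero hUc hκ h0 hwz hz))

/-- An injective holomorphic function `κ` on the disc generates, on every smaller closed disc,
a closed algebra containing all holomorphic functions on the disc (up to boundary values). -/
lemma exists_mem_elemental_eq {κ f : ℂ → ℂ} (hκ : DifferentiableOn ℂ κ disc)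
    (hinj : InjOn κ disc) (hf : DifferentiableOn ℂ f disc) {r : ℝ} (hr0 : 0 ≤ r) (hr : r < 1) :
    ∃ g ∈ Algebra.elemental ℂ (restrictClosedBall κ hκ hr),
      ∀ z : closedBall (0 : ℂ) r, ‖(z : ℂ)‖ < r → g z = f z := by
  set k := restrictClosedBall κ hκ hr with hk
  set a : Algebra.elemental ℂ k := ⟨k, Algebra.elemental.self_mem ℂ _⟩ with ha
  obtain ⟨R, hrR, hR⟩ := exists_between hr
  have hR0 : 0 ≤ R := hr0.trans hrR.le
  have hres : ∀ w ∈ sphere (0 : ℂ) R, κ w ∈ resolventSet ℂ a := fun w hw => by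
    rw [mem_sphere_zero_iff_norm] at hw
    exact mem_resolventSet_elemental hκ hinj hr0 hr (hw ▸ hrR) (hw ▸ hR)
  have hsub : sphere (0 : ℂ) R ⊆ disc :=
    sphere_subset_closedBall.trans (closedBall_subset_ball hR)
  set F : ℂ → Algebra.elemental ℂ k := fun w => (f w * deriv κ w) • resolvent a (κ w) with hF
  have hFc : ContinuousOn F (sphere 0 R) := by
    refine ContinuousOn.smul ((hf.continuousOn.mul
      (hκ.deriv isOpen_ball).continuousOn).mono hsub) fun w hw => ?_
    exact (spectrum.hasDerivAt_resolvent_const_left (hres w hw)).continuousAt.comp_continuousWithinAt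
      ((hκ.continuousOn.mono hsub) w hw)
  let ev (z : closedBall (0 : ℂ) r) : Algebra.elemental ℂ k →L[ℂ] ℂ :=
    (ContinuousMap.evalCLM ℂ z).comp (Algebra.elemental ℂ k).toSubmodule.subtypeL
  have hev : ∀ z : closedBall (0 : ℂ) r, ∀ w ∈ sphere (0 : ℂ) R,
      ev z (F w) = f w * deriv κ w * (κ w - κ z)⁻¹ := by
    intro z w hw
    have h1 : (algebraMap ℂ _ (κ w) - a) * resolvent a (κ w) = 1 :=
      Ring.mul_inverse_cancel _ (hres w hw)
    have h2 : (κ w - κ z) * ev z (resolvent a (κ w)) = 1 :=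
      DFunLike.congr_fun (congrArg Subtype.val h1) z
    rw [hF]
    simp only [map_smul, smul_eq_mul]
    rw [eq_inv_of_mul_eq_one_right h2]
  set G : Algebra.elemental ℂ k := (2 * Real.pi * Complex.I : ℂ)⁻¹ • ∮ w in C(0, R), F w with hG
  have hevG : ∀ z, ev z G = (2 * Real.pi * Complex.I : ℂ)⁻¹ •
      ∮ w in C(0, R), f w * deriv κ w * (κ w - κ z)⁻¹ := by
    intro z
    rw [hG, map_smul, ← circleIntegral.integral_congr hR0 (hev z), circleIntegral, circleIntegral,
      ← ContinuousLinearMap.intervalIntegral_comp_comm _ (hFc.circleIntegrable hR0).out]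
    simp only [map_smul]
  have hpi : (2 * Real.pi * Complex.I : ℂ) ≠ 0 := Complex.two_pi_I_ne_zero
  have hgood : ∀ z : closedBall (0 : ℂ) r, deriv κ z ≠ 0 → (G : C(closedBall (0 : ℂ) r, ℂ)) z = f z := by
    intro z hz
    have : ev z G = f z := by
      rw [hevG, circleIntegral_mul_deriv_div_sub hκ hinj hf hR
        ((mem_closedBall_zero_iff.1 z.2).trans_lt hrR) hz, smul_eq_mul, inv_mul_cancel_left₀ hpi]
    exact this
  refine ⟨G, G.2, fun z hz => ?_⟩
  have hzd : (z : ℂ) ∈ disc := mem_ball_zero_iff.2 (hz.trans hr)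
  have hnb : ball (0 : ℂ) r ∈ 𝓝 (z : ℂ) := isOpen_ball.mem_nhds (mem_ball_zero_iff.2 hz)
  -- Zeros of `κ'` are isolated, so continuity extends the equality to them.
  have hl : Tendsto (G : C(closedBall (0 : ℂ) r, ℂ)) (comap (↑) (𝓝[≠] (z : ℂ)))
      (𝓝 ((G : C(closedBall (0 : ℂ) r, ℂ)) z)) :=
    (map_continuous _).continuousAt.tendsto.mono_left (by
      rw [nhds_subtype]; exact comap_mono nhdsWithin_le_nhds)
  have hl' : Tendsto (fun w : closedBall (0 : ℂ) r => f w) (comap (↑) (𝓝[≠] (z : ℂ)))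
      (𝓝 (f z)) :=
    ((hf.continuousOn.continuousAt (isOpen_ball.mem_nhds hzd)).tendsto.mono_left
      nhdsWithin_le_nhds).comp tendsto_comap
  have : (comap ((↑) : closedBall (0 : ℂ) r → ℂ) (𝓝[≠] (z : ℂ))).NeBot := by
    rw [comap_neBot_iff]
    intro t ht
    obtain ⟨w, hw, hwr⟩ := Filter.nonempty_of_mem (inter_mem ht (nhdsWithin_le_nhds hnb))
    exact ⟨⟨w, ball_subset_closedBall hwr⟩, hw⟩
  refine tendsto_nhds_unique_of_eventuallyEq hl hl' ?_
  have := (eventually_deriv_ne_zero_of_injOn isOpen_ball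
    (convex_ball _ _).isPreconnected hκ hinj hzd).comap ((↑) : closedBall (0 : ℂ) r → ℂ)
  filter_upwards [this] with w hw using hgood w hw

/-- A Runge theorem: polynomials in an injective holomorphic function on the disc approximate
every holomorphic function uniformly on smaller discs. -/
theorem exists_polynomial_norm_sub_lt {κ f : ℂ → ℂ} (hκ : DifferentiableOn ℂ κ disc)
    (hinj : InjOn κ disc) (hf : DifferentiableOn ℂ f disc) {r : ℝ} (hr0 : 0 ≤ r) (hr : r < 1)
    {ε : ℝ} (hε : 0 < ε) :
    ∃ p : ℂ[X], ∀ z ∈ ball (0 : ℂ) r, ‖f z - p.eval (κ z)‖ < ε := by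
  obtain ⟨g, hg, hgf⟩ := exists_mem_elemental_eq hκ hinj hf hr0 hr
  obtain ⟨h, hh, hgh⟩ := Metric.mem_closure_iff.1 hg ε hε
  rw [SetLike.mem_coe, Algebra.adjoin_singleton_eq_range_aeval] at hh
  obtain ⟨p, rfl⟩ := hh
  refine ⟨p, fun z hz => ?_⟩
  have hzK := ball_subset_closedBall hz
  have h1 := (ContinuousMap.dist_apply_le_dist (⟨z, hzK⟩ : closedBall (0 : ℂ) r)).trans_lt hgh
  have h2 : aeval (restrictClosedBall κ hκ hr) p ⟨z, hzK⟩ = p.eval (κ z) := by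
    have := Polynomial.aeval_algHom_apply
      (ContinuousMap.evalAlgHom ℂ ℂ (⟨z, hzK⟩ : closedBall (0 : ℂ) r))
      (restrictClosedBall κ hκ hr) p
    exact this.symm.trans (by rw [Polynomial.coe_aeval_eq_eval]; rfl)
  rw [hgf _ (mem_ball_zero_iff.1 hz), dist_eq_norm] at h1
  simpa [h2] using h1

end Koenigs

/-! ### Schwarz lemma, convergence of iterates and injectivity of `κ`. -/

namespace Koenigs

open Metric Set Filter Topology Function
open scoped ComplexConjugate

/-- The involutive automorphism of the disc that exchanges `0` and `α`. -/
noncomputable def moebius (α z : ℂ) : ℂ := (α - z) / (1 - conj α * z)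

lemma moebius_denom_ne_zero {α z : ℂ} (hα : α ∈ disc) (hz : z ∈ disc) : 1 - conj α * z ≠ 0 := by
  intro h
  have h1 : ‖conj α * z‖ < 1 := by
    rw [norm_mul, RCLike.norm_conj]
    exact mul_lt_one_of_nonneg_of_lt_one_left (norm_nonneg _) (mem_ball_zero_iff.1 hα)
      (mem_ball_zero_iff.1 hz).le
  rw [← sub_eq_zero.1 h, norm_one] at h1
  exact lt_irrefl _ h1

lemma mapsTo_moebius {α : ℂ} (hα : α ∈ disc) : MapsTo (moebius α) disc disc := by
  intro z hz
  have hd := moebius_denom_ne_zero hα hz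
  rw [mem_ball_zero_iff] at hα hz ⊢
  rw [moebius, norm_div, div_lt_one (norm_pos_iff.2 hd), ← sq_lt_sq₀ (norm_nonneg _) (norm_nonneg _)]
  have h1 : ‖1 - conj α * z‖ ^ 2 - ‖α - z‖ ^ 2 = (1 - ‖α‖ ^ 2) * (1 - ‖z‖ ^ 2) := by
    simp only [Complex.sq_norm, Complex.normSq_apply, Complex.sub_re, Complex.sub_im,
      Complex.mul_re, Complex.mul_im, Complex.conj_re, Complex.conj_im, Complex.one_re,
      Complex.one_im]
    ring
  have h2 : 0 < (1 - ‖α‖ ^ 2) * (1 - ‖z‖ ^ 2) :=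
    mul_pos (sub_pos.2 (pow_lt_one₀ (norm_nonneg _) hα two_ne_zero))
      (sub_pos.2 (pow_lt_one₀ (norm_nonneg _) hz two_ne_zero))
  linarith

lemma differentiableOn_moebius {α : ℂ} (hα : α ∈ disc) :
    DifferentiableOn ℂ (moebius α) disc := by
  unfold moebius
  exact DifferentiableOn.div (by fun_prop) (by fun_prop) fun z hz => moebius_denom_ne_zero hα hz

lemma moebius_moebius {α z : ℂ} (hα : α ∈ disc) (hz : z ∈ disc) :
    moebius α (moebius α z) = z := by
  have h1 := moebius_denom_ne_zero hα hz
  have h2 := moebius_denom_ne_zero hα (mapsTo_moebius hα hz)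
  have h3 : moebius α z * (1 - conj α * z) = α - z := div_mul_cancel₀ _ h1
  rw [moebius.eq_1 α (moebius α z), div_eq_iff h2]
  linear_combination -h3

@[simp] lemma moebius_zero (α : ℂ) : moebius α 0 = α := by simp [moebius]

@[simp] lemma moebius_self (α : ℂ) : moebius α α = 0 := by simp [moebius]

lemma isHolSelfMap_moebius {α : ℂ} (hα : α ∈ disc) : IsHolSelfMap (moebius α) :=
  ⟨differentiableOn_moebius hα, mapsTo_moebius hα⟩

lemma IsHolSelfMap.comp {f g : ℂ → ℂ} (hf : IsHolSelfMap f) (hg : IsHolSelfMap g) :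
    IsHolSelfMap (f ∘ g) :=
  ⟨hf.1.comp hg.1 hg.2, hf.2.comp hg.2⟩

lemma isHolSelfMap_mul_const {c : ℂ} (hc : ‖c‖ = 1) : IsHolSelfMap (· * c) := by
  refine ⟨by fun_prop, fun z hz => ?_⟩
  rw [mem_ball_zero_iff] at hz ⊢
  simpa [hc] using hz

/-- A disc map with a fixed point that, after moving the fixed point to the origin, attains
equality in the Schwarz lemma is an automorphism. -/
lemma isDiscAut_of_norm_dslope_eq_one {φ : ℂ → ℂ} {α : ℂ} (hφ : IsHolSelfMap φ) (hα : α ∈ disc)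
    (hfix : φ α = α) {z₀ : ℂ} (hz₀ : z₀ ∈ disc)
    (h : ‖dslope (moebius α ∘ φ ∘ moebius α) 0 z₀‖ = 1) : IsDiscAut φ := by
  set ψ := moebius α ∘ φ ∘ moebius α with hψ
  have hm := isHolSelfMap_moebius hα
  have hψs : IsHolSelfMap ψ := hm.comp (hφ.comp hm)
  have hψ0 : ψ 0 = 0 := by simp [hψ, hfix]
  set c := dslope ψ 0 z₀
  have hlin : EqOn ψ (fun z => ψ 0 + (z - 0) • c) disc :=
    Complex.affine_of_mapsTo_ball_of_norm_dslope_eq_div (R₂ := 1) hψs.1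
      (by rw [hψ0]; exact hψs.2.mono_right ball_subset_closedBall) hz₀ (by simpa using h)
  simp only [hψ0, zero_add, sub_zero, smul_eq_mul] at hlin
  have hc0 : c ≠ 0 := norm_pos_iff.1 (h ▸ one_pos)
  have hci : ‖c⁻¹‖ = 1 := by rw [norm_inv, h, inv_one]
  have hrot := isHolSelfMap_mul_const hci
  -- Since `ψ` is rotation by `c`, the inverse of `φ` is rotation by `c⁻¹` conjugated by `moebius
  -- α`.
  refine ⟨hφ, _, hm.comp (hrot.comp hm), fun z hz => ?_, fun z hz => ?_⟩
  · have h1 : moebius α (φ z) = moebius α z * c := by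
      simpa [hψ, moebius_moebius hα hz] using hlin (hm.2 hz)
    simp [h1, mul_inv_cancel_right₀ hc0, moebius_moebius hα hz]
  · have hw := hrot.2 (hm.2 hz)
    have h1 : moebius α (φ (moebius α (moebius α z * c⁻¹))) = moebius α z := by
      simpa [hψ, inv_mul_cancel_right₀ hc0] using hlin hw
    have h2 := congrArg (moebius α) h1
    rwa [moebius_moebius hα hz, moebius_moebius hα (hφ.2 (hm.2 hw))] at h2

/-- The iterates of a disc map that is not an automorphism converge to its fixed point. -/
theorem tendsto_iterate_fixedPoint {φ : ℂ → ℂ} {α : ℂ} (hφ : IsHolSelfMap φ)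
    (hna : ¬ IsDiscAut φ) (hα : α ∈ disc) (hfix : φ α = α) {z : ℂ} (hz : z ∈ disc) :
    Tendsto (fun n => φ^[n] z) atTop (𝓝 α) := by
  set ψ := moebius α ∘ φ ∘ moebius α with hψ
  have hm := isHolSelfMap_moebius hα
  have hψs : IsHolSelfMap ψ := hm.comp (hφ.comp hm)
  have hψ0 : ψ 0 = 0 := by simp [hψ, hfix]
  have h0 : (0 : ℂ) ∈ disc := mem_ball_self one_pos
  have hlt : ∀ w ∈ disc, ‖dslope ψ 0 w‖ < 1 := fun w hw => by
    refine lt_of_le_of_ne ?_ fun h => hna (isDiscAut_of_norm_dslope_eq_one hφ hα hfix hw h)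
    simpa using Complex.norm_dslope_le_div_of_mapsTo_ball (R₂ := 1) hψs.1
      (by rw [hψ0]; exact hψs.2.mono_right ball_subset_closedBall) hw
  set r := ‖moebius α z‖ with hr
  have hr1 : r < 1 := mem_ball_zero_iff.1 (hm.2 hz)
  have hsub : closedBall (0 : ℂ) r ⊆ disc := closedBall_subset_ball hr1
  have hcont : ContinuousOn (fun w => ‖dslope ψ 0 w‖) (closedBall 0 r) :=
    (((Complex.differentiableOn_dslope (isOpen_ball.mem_nhds h0)).2
      hψs.1).continuousOn.mono hsub).norm
  -- Compactness turns the strict pointwise Schwarz bound into a uniform contraction factor.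
  obtain ⟨w₀, hw₀, hmax⟩ := (isCompact_closedBall (0 : ℂ) r).exists_isMaxOn
    ⟨0, mem_closedBall_self (norm_nonneg _)⟩ hcont
  set c := ‖dslope ψ 0 w₀‖ with hc
  have hc0 : 0 ≤ c := norm_nonneg _
  have hc1 : c < 1 := hlt w₀ (hsub hw₀)
  have hcontr : ∀ w ∈ closedBall (0 : ℂ) r, ‖ψ w‖ ≤ c * ‖w‖ := fun w hw => by
    have : ψ w = w * dslope ψ 0 w := by
      simpa [hψ0] using (sub_smul_dslope ψ 0 w).symm
    rw [this, norm_mul, mul_comm]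
    exact mul_le_mul_of_nonneg_right (hmax hw) (norm_nonneg _)
  have hit : ∀ n, φ^[n] z ∈ disc := fun n => hφ.2.iterate n hz
  have hbound : ∀ n, ‖moebius α (φ^[n] z)‖ ≤ c ^ n * r := by
    intro n
    induction n with
    | zero => simp [hr]
    | succ n ih =>
      have hmem : moebius α (φ^[n] z) ∈ closedBall (0 : ℂ) r :=
        mem_closedBall_zero_iff.2 (ih.trans
          (mul_le_of_le_one_left (norm_nonneg _) (pow_le_one₀ hc0 hc1.le)))
      have h1 := hcontr _ hmem
      rw [iterate_succ_apply', pow_succ', mul_assoc]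
      simp only [hψ, comp_apply, moebius_moebius hα (hit n)] at h1
      exact h1.trans (mul_le_mul_of_nonneg_left ih hc0)
  have hlim : Tendsto (fun n => moebius α (φ^[n] z)) atTop (𝓝 0) :=
    squeeze_zero_norm hbound (by
      simpa using (tendsto_pow_atTop_nhds_zero_of_lt_one hc0 hc1).mul_const r)
  have hca : ContinuousAt (moebius α) 0 := hm.1.continuousOn.continuousAt (isOpen_ball.mem_nhds h0)
  have := hca.tendsto.comp hlim
  simpa [comp_def, moebius_moebius hα (hit _)] using this

/-- The Koenigs eigenfunction of a univalent Schröder map is univalent. -/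
theorem IsKoenigsEigenfunction.injOn {φ : ℂ → ℂ} {α : ℂ} (hφ : IsSchroederMap φ α) {κ : ℂ → ℂ}
    (hκ : IsKoenigsEigenfunction φ α κ) (hinj : InjOn φ disc) : InjOn κ disc := by
  have hmaps := hφ.holSelfMap.2
  have heig : ∀ n, ∀ z ∈ disc, κ (φ^[n] z) = deriv φ α ^ n * κ z := by
    intro n z hz
    induction n with
    | zero => simp
    | succ n ih => rw [iterate_succ_apply', hκ.eigen _ (hmaps.iterate n hz), ih, pow_succ', mul_assoc]
  have hstrict : HasStrictDerivAt κ (1 : ℂ) α := by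
    rw [← hκ.deriv_eq_one]
    exact (hκ.hol.analyticAt (isOpen_ball.mem_nhds hφ.mem_disc)).hasStrictDerivAt
  have hloc := hstrict.eventually_left_inverse one_ne_zero
  have hlim := fun {z : ℂ} (hz : z ∈ disc) => (tendsto_iterate_fixedPoint hφ.holSelfMap hφ.not_aut
    hφ.mem_disc hφ.fixed hz).eventually hloc
  intro a ha b hb hab
  obtain ⟨n, hna, hnb⟩ := ((hlim ha).and (hlim hb)).exists
  have h1 : φ^[n] a = φ^[n] b := by
    rw [← hna, ← hnb, heig n a ha, heig n b hb, hab]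
  exact hinj.iterate hmaps n ha hb h1

end Koenigs

/-! ### Density of the span versus injectivity of `κ`. -/

namespace Koenigs

open Metric Set Filter Topology Polynomial

lemma continuous_eval_Hol (z : disc) : Continuous fun f : Hol => (f : C(disc, ℂ)) z :=
  (continuous_eval_const z).comp continuous_subtype_val

/-- If the powers of `κ` span a dense subspace, then `κ` separates points. -/
theorem injOn_of_dense_span {κ : ℂ → ℂ} (hκ : DifferentiableOn ℂ κ disc)
    (h : Dense (Submodule.span ℂ (range fun n : ℕ => toHol κ hκ ^ n) : Set Hol)) :
    InjOn κ disc := by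
  intro a ha b hb hab
  have hsub : (Submodule.span ℂ (range fun n : ℕ => toHol κ hκ ^ n) : Set Hol) ⊆
      {f | (f : C(disc, ℂ)) ⟨a, ha⟩ = (f : C(disc, ℂ)) ⟨b, hb⟩} := by
    intro f hf
    induction hf using Submodule.span_induction with
    | mem x hx =>
      obtain ⟨n, rfl⟩ := hx
      exact congrArg (· ^ n) hab
    | zero => rfl
    | add x y _ _ hx hy => exact congrArg₂ (· + ·) hx hy
    | smul c x _ hx => exact congrArg (c * ·) hx
  have hcl : IsClosed {f : Hol | (f : C(disc, ℂ)) ⟨a, ha⟩ = (f : C(disc, ℂ)) ⟨b, hb⟩} :=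
    isClosed_eq (continuous_eval_Hol _) (continuous_eval_Hol _)
  exact closure_minimal hsub hcl (h (toHol id differentiableOn_id))

/-- The powers of an injective holomorphic function on the disc span a dense subspace. -/
theorem dense_span_of_injOn {κ : ℂ → ℂ} (hκ : DifferentiableOn ℂ κ disc) (hinj : InjOn κ disc) :
    Dense (Submodule.span ℂ (range fun n : ℕ => toHol κ hκ ^ n) : Set Hol) := by
  rw [IsInducing.subtypeVal.dense_iff]
  rintro ⟨f, F, hF, hf⟩
  rw [mem_closure_iff_nhds_basis
    (nhds_basis_uniformity' (uniformity_basis_dist (α := ℂ)).compactConvergenceUniformity)]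
  rintro ⟨K, ε⟩ ⟨hK, hε⟩
  obtain ⟨r, hr, hKr⟩ := exists_lt_subset_ball (hK.image continuous_subtype_val).isClosed
    (Subtype.coe_image_subset _ K : _ ⊆ ball (0 : ℂ) 1)
  -- The radius `r` may be negative when `K` is empty, hence the maximum with `0`.
  obtain ⟨p, hp⟩ := exists_polynomial_norm_sub_lt hκ hinj hF (le_max_right r 0)
    (max_lt hr one_pos) hε
  refine ⟨_, ⟨aeval (toHol κ hκ) p, ?_, rfl⟩, fun z hz => ?_⟩
  · rw [aeval_eq_sum_range]
    exact Submodule.sum_mem _ fun i _ =>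
      Submodule.smul_mem _ _ (Submodule.subset_span (mem_range_self i))
  · have h1 : ((aeval (toHol κ hκ) p : Hol) : C(disc, ℂ)) z = p.eval (κ z) := by
      have := aeval_algHom_apply ((ContinuousMap.evalAlgHom ℂ ℂ z).comp Hol.val) (toHol κ hκ) p
      exact this.symm.trans (by rw [coe_aeval_eq_eval]; rfl)
    have h2 := hp z (ball_subset_ball (le_max_left r 0) (hKr (mem_image_of_mem _ hz)))
    rw [mem_ofPred_eq, dist_eq_norm]
    simpa [h1, hf] using h2

end Koenigs

theorem proposition3p5 (φ : ℂ → ℂ) (α : ℂ) (hφ : Koenigs.IsSchroederMap φ α)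
    (κ : ℂ → ℂ) (hκ : Koenigs.IsKoenigsEigenfunction φ α κ) :
    Dense (Submodule.span ℂ (Set.range fun n : ℕ => Koenigs.toHol κ hκ.hol ^ n) :
        Set Koenigs.Hol) ↔
      Set.InjOn φ Koenigs.disc := by
  refine ⟨fun h a ha b hb hab => Koenigs.injOn_of_dense_span hκ.hol h ha hb ?_,
    fun h => Koenigs.dense_span_of_injOn hκ.hol (hκ.injOn hφ h)⟩
  have := congrArg κ hab
  rw [hκ.eigen a ha, hκ.eigen b hb] at this
  exact mul_left_cancel₀ hφ.deriv_ne_zero this
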